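/- Let $G$ be a finite simple graph. Call $G$ locally irregular if any two adjacent vertices of $G$ have distinct degrees. A locally irregular edge-coloring of $G$ is a (not necessarily proper) coloring of its edges such that, for every color, the graph formed by the edges of that color is locally irregular. Let $\chi'_{\mathrm{irr}}(G)$ denote the smallest number of colors in a locally irregular edge-coloring of $G$, with $\chi'_{\mathrm{irr}}(G)=\infty$ if $G$ has no such coloring. Call $G$ balanced if it is bipartite and has a bipartition in which all vertices of one of the two parts have even degree in $G$. Then every balanced graph $G$ satisfies $$\chi'_{\mathrm{irr}}(G)\le 4 .$$ In particular, every balanced graph admits a locally irregular edge-coloring. -/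

import Mathlib

namespace SimpleGraph

open Classical in
/-- A finite graph is locally irregular if adjacent vertices always have distinct degrees. -/
def IsLocallyIrregular {V : Type*} [Fintype V] (G : SimpleGraph V) : Prop :=
  ∀ ⦃v w : V⦄, G.Adj v w → G.degree v ≠ G.degree w

/-- A (not necessarily proper) edge-coloring is locally irregular if each color class is a locally
irregular graph. The graph `C.labelGraph k` has the edges of color `k` on all of `V`; its isolated
vertices do not matter for local irregularity. -/
def EdgeLabeling.IsLocallyIrregular {V : Type*} [Fintype V] {G : SimpleGraph V} {K : Type*}
    (C : G.EdgeLabeling K) : Prop :=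
  ∀ k : K, (C.labelGraph k).IsLocallyIrregular

/-- `G` has a locally irregular edge-coloring with (at most) `n` colors. -/
def LocallyIrregularEdgeColorable {V : Type*} [Fintype V] (G : SimpleGraph V) (n : ℕ) : Prop :=
  ∃ C : G.EdgeLabeling (Fin n), C.IsLocallyIrregular

/-- The locally irregular chromatic index: the least number of colors in a locally irregular
edge-coloring of `G`. It is `⊤` exactly when `G` has no such coloring, that is, when `G` is not
decomposable. -/
noncomputable def locallyIrregularChromaticIndex {V : Type*} [Fintype V] (G : SimpleGraph V) : ℕ∞ :=
  ⨅ n ∈ {n : ℕ | G.LocallyIrregularEdgeColorable n}, (n : ℕ∞)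

open Classical in
/-- `G` is balanced if it has a bipartition of its vertex set into two parts, the first of which
contains only vertices of even degree. -/
def IsBalanced {V : Type*} [Fintype V] (G : SimpleGraph V) : Prop :=
  ∃ E N : Set V, IsCompl E N ∧ G.IsBipartiteWith E N ∧ ∀ v ∈ E, Even (G.degree v)

end SimpleGraph

namespace SimpleGraph

/-! Parity separates the two ends of most edges. Let `X` be the part with even degrees and `E` the
set of non-isolated vertices of even degree in the other part; work in one component. If `|E|` is
even, a spanning tree contains a forest `F` whose vertices of odd degree are exactly those in `E`
(`exists_le_odd_degree_iff_mem`). Outside `F` the degrees in `X` are even, and those in the other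
part are odd or zero, so one color suffices there. Two more colors handle `F`: all edges at a vertex
of `X` get the same color, chosen so that each vertex of the other part sees an odd number or none
of each color (`IsAcyclic.exists_two_coloring`).

If `|E|` is odd, a vertex `b₀` outside `X` whose removal keeps the rest connected is set aside. Now
`F` avoids `b₀` and has odd degree exactly on `N(b₀) ∪ (E \ {b₀})`, which has even size. Let `U` be
`F` together with the star at `b₀`; one color again suffices outside `U`. A fourth color takes a
locally irregular `S ⊆ U`: a path of length two if `b₀` has degree at most two, and otherwise the
star with some of its leaves extended by an edge. What remains of `U` is a forest with even degrees
in `X`, apart from leaves that come in even numbers at each vertex, and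
`IsAcyclic.exists_two_coloring_of_leaves` still applies. The extensions can be chosen because `b₀`
ends a longest path contained, up to `b₀`, in the spanning tree (`exists_vertex_spanning_tree`). -/

/-- Otherwise a connection avoiding `z` would close a cycle through `z`. -/
theorem IsAcyclic.eq_of_adj_of_reachable {V : Type*} {T : SimpleGraph V} (hT : T.IsAcyclic) {x y z : V}
    (hx : T.Adj x z) (hy : T.Adj y z) (h : (T.deleteIncidenceSet z).Reachable x y) : x = y := by
  by_contra hne
  have hb := isAcyclic_iff_forall_adj_isBridge.1 hT hx
  rw [isBridge_iff] at hb
  apply hb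
  have h1 : (T.deleteEdges {s(x, z)}).Reachable x y := by
    refine h.mono fun u v huv => ?_
    rw [deleteIncidenceSet_adj] at huv
    rw [deleteEdges_adj]
    refine ⟨huv.1, ?_⟩
    simp only [Set.mem_singleton_iff, Sym2.eq_iff]
    tauto
  refine h1.trans (Adj.reachable ?_)
  rw [deleteEdges_adj]
  refine ⟨hy, ?_⟩
  simp only [Set.mem_singleton_iff, Sym2.eq_iff]
  rintro (⟨h, -⟩ | ⟨h, -⟩)
  · exact hne h.symm
  · exact hy.ne h

/-! ### Subgraphs with prescribed degree parities -/

variable {V : Type*} [Finite V]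

theorem ncard_and_add_ncard_and_not (P Q : V → Prop) :
    {x | P x ∧ Q x}.ncard + {x | P x ∧ ¬ Q x}.ncard = {x | P x}.ncard :=
  Set.ncard_inter_add_ncard_sdiff_eq_ncard {x | P x} {x | Q x}

theorem odd_ncard_xor (P Q : V → Prop) :
    Odd {x | Xor (P x) (Q x)}.ncard ↔ Xor (Odd {x | P x}.ncard) (Odd {x | Q x}.ncard) := by
  have h1 := ncard_and_add_ncard_and_not P Q
  have h2 := ncard_and_add_ncard_and_not Q P
  have h3 := ncard_and_add_ncard_and_not (fun x => Xor (P x) (Q x)) P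
  have e1 : {x | Xor (P x) (Q x) ∧ P x} = {x | P x ∧ ¬ Q x} := by
    ext x; simp only [Set.mem_ofPred_eq, Xor]; tauto
  have e2 : {x | Xor (P x) (Q x) ∧ ¬ P x} = {x | Q x ∧ ¬ P x} := by
    ext x; simp only [Set.mem_ofPred_eq, Xor]; tauto
  have e3 : {x | Q x ∧ P x} = {x | P x ∧ Q x} := by
    ext x; simp only [Set.mem_ofPred_eq]; tauto
  rw [e1, e2] at h3
  rw [e3] at h2
  rw [← h1, ← h2, ← h3]
  simp only [Xor, Nat.odd_iff]
  omega

/-- The graph formed by the edges lying in exactly one of two subgraphs of `T`. -/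
theorem exists_le_odd_degree_xor {T F₁ F₂ : SimpleGraph V} (h₁ : F₁ ≤ T) (h₂ : F₂ ≤ T) :
    ∃ F ≤ T, ∀ v, Odd {w | F.Adj v w}.ncard ↔
      Xor (Odd {w | F₁.Adj v w}.ncard) (Odd {w | F₂.Adj v w}.ncard) := by
  refine ⟨⟨fun v w => Xor (F₁.Adj v w) (F₂.Adj v w), ⟨fun v w h => ?_⟩, ⟨fun v h => ?_⟩⟩, fun v w h => ?_,
    fun v => odd_ncard_xor _ _⟩
  · simpa only [adj_comm] using h
  · simp [Xor] at h
  · rcases h with h | h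
    exacts [h₁ h.1, h₂ h.1]

theorem Walk.exists_le_odd_degree {T : SimpleGraph V} {x y : V} (p : T.Walk x y) :
    ∃ F ≤ T, ∀ v, Odd {w | F.Adj v w}.ncard ↔ Xor (v = x) (v = y) := by
  induction p with
  | nil => exact ⟨⊥, bot_le, fun v => by simp⟩
  | @cons x z y h p ih =>
    obtain ⟨F, hF, hp⟩ := ih
    have hle : edge x z ≤ T := (edge_le_iff T).2 (Or.inr h)
    obtain ⟨F', hF', hp'⟩ := exists_le_odd_degree_xor hle hF
    refine ⟨F', hF', fun v => ?_⟩
    rw [hp', hp]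
    have : Odd {w | (edge x z).Adj v w}.ncard ↔ Xor (v = x) (v = z) := by
      have hne := h.ne
      by_cases hx : v = x
      · have : {w | (edge x z).Adj v w} = {z} := by
          ext w; simp [edge_adj, hx]; grind
        rw [this]; simp [Xor, hx, hne]
      · by_cases hz : v = z
        · have : {w | (edge x z).Adj v w} = {x} := by
            ext w; simp [edge_adj, hz]; grind
          rw [this]; simp [Xor, hz, hne.symm]
        · have : {w | (edge x z).Adj v w} = ∅ := by
            ext w; simp [edge_adj]; grind
          rw [this]; simp [Xor, hx, hz]
    rw [this]
    simp only [Xor]; tauto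

/-- A graph has a subgraph whose vertices of odd degree are prescribed, if they are evenly many
and pairwise connected. -/
theorem exists_le_odd_degree_iff_mem (T : SimpleGraph V) (S : Set V) (hS : Even S.ncard)
    (hT : ∀ v ∈ S, ∀ w ∈ S, T.Reachable v w) :
    ∃ F ≤ T, ∀ v, Odd {w | F.Adj v w}.ncard ↔ v ∈ S := by
  rcases S.eq_empty_or_nonempty with rfl | ⟨r, hr⟩
  · exact ⟨⊥, bot_le, fun v => by simp⟩
  -- Add up modulo 2 one path to `r` from each vertex of `s`. The root absorbs the parity of `|s|`,
  -- which vanishes for `s = S`.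
  have key : ∀ s : Set V, s ⊆ S → ∃ F ≤ T, ∀ v, Odd {w | F.Adj v w}.ncard ↔
      Xor (v ∈ s) (v = r ∧ Odd s.ncard) := by
    intro s
    induction s, s.toFinite using Set.Finite.induction_on with
    | empty => exact fun _ => ⟨⊥, bot_le, fun v => by simp⟩
    | @insert a s ha _ ih =>
      intro hs
      obtain ⟨F₁, hF₁, h₁⟩ := ih ((Set.subset_insert _ _).trans hs)
      obtain ⟨p⟩ := hT a (hs (Set.mem_insert _ _)) r hr
      obtain ⟨F₂, hF₂, h₂⟩ := p.exists_le_odd_degree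
      obtain ⟨F, hF, h⟩ := exists_le_odd_degree_xor hF₁ hF₂
      refine ⟨F, hF, fun v => ?_⟩
      rw [h, h₁, h₂, Set.ncard_insert_of_notMem ha, Set.mem_insert_iff, Nat.odd_add_one]
      by_cases hv : v = a
      · subst hv; simp only [Xor]; tauto
      · simp only [Xor]; tauto
  obtain ⟨F, hF, h⟩ := key S subset_rfl
  refine ⟨F, hF, fun v => ?_⟩
  rw [h, ← Nat.not_even_iff_odd]
  simp only [Xor]; tauto

/-! ### Two-colorings of forests -/

/-- The vertices of `X` in a forest can be two-colored such that every other vertex has an odd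
number of neighbors, or none at all, of each color. -/
theorem IsAcyclic.exists_two_coloring {F : SimpleGraph V} (hF : F.IsAcyclic) {X : Set V}
    (hX : ∀ ⦃v w⦄, F.Adj v w → (v ∈ X ↔ w ∉ X)) :
    ∃ c : V → Bool, ∀ b ∉ X, ∀ i, {a | F.Adj a b ∧ c a = i} = ∅ ∨
      Odd {a | F.Adj a b ∧ c a = i}.ncard := by
  classical
  induction F using WellFoundedLT.induction with
  | ind F ih =>
  by_cases hb : ∃ b ∉ X, ∃ a, F.Adj a b
  swap
  · push Not at hb
    exact ⟨fun _ => true, fun b hbX i => Or.inl (by ext a; simp [hb b hbX a])⟩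
  obtain ⟨b, hbX, a₁, ha₁⟩ := hb
  set F' := F.deleteIncidenceSet b with hF'
  have hadj : ∀ v w, F'.Adj v w ↔ F.Adj v w ∧ v ≠ b ∧ w ≠ b := fun _ _ => deleteIncidenceSet_adj
  have hle : F' ≤ F := deleteIncidenceSet_le F b
  have hlt : F' < F := lt_of_le_of_ne hle fun h => by
    rw [← h, hadj] at ha₁; exact ha₁.2.2 rfl
  obtain ⟨c', hc'⟩ := ih F' hlt (hF.anti hle) fun v w h => hX (hle h)
  -- The neighbors of `b` lie in distinct components once `b` is cut off, so the colors of whole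
  -- components can be flipped to give these neighbors any desired colors. A flip preserves the
  -- condition at every other vertex.
  have hinj : Set.InjOn F'.connectedComponentMk {a | F.Adj a b} := fun x hx y hy hxy =>
    hF.eq_of_adj_of_reachable hx hy (ConnectedComponent.exact hxy)
  set k := {a | F.Adj a b}.ncard with hk
  -- For odd `k` all neighbors of `b` get the same color; for even `k` they split as `1 + (k - 1)`,
  -- both odd.
  set want : V → Bool := fun a => decide (a = a₁ ∨ Odd k) with hwant
  have : Nonempty V := ⟨b⟩
  let φ : F'.ConnectedComponent → Bool := fun K =>
    let a := Function.invFunOn F'.connectedComponentMk {a | F.Adj a b} K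
    xor (c' a) (want a)
  have hφ : ∀ a, F.Adj a b → φ (F'.connectedComponentMk a) = xor (c' a) (want a) := by
    intro a ha
    have := hinj.leftInvOn_invFunOn ha
    simp only [φ]
    rw [this]
  refine ⟨fun x => xor (c' x) (φ (F'.connectedComponentMk x)), fun b' hb' i => ?_⟩
  by_cases hbb : b' = b
  · subst hbb
    have hset : {a | F.Adj a b' ∧ xor (c' a) (φ (F'.connectedComponentMk a)) = i} =
        {a | F.Adj a b' ∧ want a = i} := by
      ext a
      simp only [Set.mem_ofPred_eq, and_congr_right_iff]
      intro ha
      rw [hφ a ha]; simp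
    rw [hset]
    by_cases hodd : Odd k
    · cases i
      · left; ext a; simp [hwant, hodd]
      · right; simpa [hwant, hodd] using (hk ▸ hodd : Odd {a | F.Adj a b'}.ncard)
    · right
      have h1 : {a | F.Adj a b' ∧ want a = true} = {a₁} := by
        ext a; simp only [hwant, hodd, or_false, decide_eq_true_eq, Set.mem_ofPred_eq, Set.mem_singleton_iff]
        grind
      cases i
      · have h2 := ncard_and_add_ncard_and_not (fun a => F.Adj a b') (fun a => want a = true)
        simp only [h1, Set.ncard_singleton, Bool.not_eq_true] at h2
        rw [Nat.not_odd_iff_even] at hodd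
        rw [← hk] at h2
        rw [← h2, add_comm, Nat.even_add_one, Nat.not_even_iff_odd] at hodd
        exact hodd
      · rw [h1]; simp
  · have hFF : ∀ a, F.Adj a b' ↔ F'.Adj a b' := by
      intro a
      rw [hadj]
      refine ⟨fun h => ⟨h, ?_, hbb⟩, fun h => h.1⟩
      rintro rfl
      exact hbX ((hX h).2 hb')
    have hconst : ∀ a, F.Adj a b' → φ (F'.connectedComponentMk a) = φ (F'.connectedComponentMk b') :=
      fun a ha => congrArg φ (ConnectedComponent.sound ((hFF a).1 ha).reachable)
    have hset : {a | F.Adj a b' ∧ xor (c' a) (φ (F'.connectedComponentMk a)) = i} =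
        {a | F'.Adj a b' ∧ c' a = xor i (φ (F'.connectedComponentMk b'))} := by
      ext a
      simp only [Set.mem_ofPred_eq, ← hFF, and_congr_right_iff]
      intro ha
      rw [hconst a ha]
      generalize c' a = x
      generalize φ _ = y
      revert x y i; decide
    rw [hset]
    exact hc' b' hb' _

/-- A two-coloring of the edges of a forest whose vertices in `X` have even degree, except for some
leaves, evenly many of which are attached to each vertex. -/
theorem IsAcyclic.exists_two_coloring_of_leaves {W : SimpleGraph V} (hW : W.IsAcyclic) {X Z : Set V}
    (hX : ∀ ⦃v w⦄, W.Adj v w → (v ∈ X ↔ w ∉ X))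
    (hZX : Z ⊆ X)
    (hZ : ∀ a ∈ Z, {b | W.Adj a b}.ncard = 1)
    (hev : ∀ a ∈ X, a ∉ Z → Even {b | W.Adj a b}.ncard)
    (hpar : ∀ b ∉ X, Even {a | W.Adj a b ∧ a ∈ Z}.ncard) :
    ∃ c : V → Bool, ∀ a ∈ X, ∀ b, W.Adj a b →
      {b' | W.Adj a b'}.ncard ≠ {a' | W.Adj a' b ∧ c a' = c a}.ncard := by
  classical
  set W' : SimpleGraph V := ⟨fun v w => W.Adj v w ∧ v ∉ Z ∧ w ∉ Z,
    ⟨fun v w h => ⟨h.1.symm, h.2.2, h.2.1⟩⟩, ⟨fun v h => W.loopless.irrefl v h.1⟩⟩ with hW'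
  have hle : W' ≤ W := fun v w h => h.1
  have hadj : ∀ a b, b ∉ X → (W'.Adj a b ↔ W.Adj a b ∧ a ∉ Z) := fun a b hb =>
    ⟨fun h => ⟨h.1, h.2.1⟩, fun h => ⟨h.1, h.2, fun hz => hb (hZX hz)⟩⟩
  obtain ⟨c, hc⟩ := (hW.anti hle).exists_two_coloring (X := X) fun v w h => hX (hle h)
  -- Only the dependence on `b` alone matters, not the color chosen: an even, positive number of
  -- leaves at `b` shares one color, so a leaf sees degree at least two at `b`, and the parities for
  -- the other vertices do not change.
  let z : V → Bool := fun b => decide ({a | W'.Adj a b ∧ c a = true}.Nonempty)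
  let nb : V → V := fun a => if h : ∃ b, W.Adj a b then h.choose else a
  have hnb : ∀ a ∈ Z, ∀ b, W.Adj a b → nb a = b := by
    intro a ha b hab
    have h : ∃ b, W.Adj a b := ⟨b, hab⟩
    obtain ⟨x, hx⟩ := Set.ncard_eq_one.1 (hZ a ha)
    have h1 : W.Adj a (nb a) := by
      simp only [nb, h, dif_pos]; exact h.choose_spec
    have h2 : nb a ∈ ({x} : Set V) := hx ▸ h1
    have h3 : b ∈ ({x} : Set V) := hx ▸ hab
    exact h2.trans h3.symm
  let col : V → Bool := fun a => if a ∈ Z then z (nb a) else c a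
  refine ⟨col, fun a ha b hab => ?_⟩
  have hb : b ∉ X := (hX hab).1 ha
  have hsplit : ∀ i, {a' | W.Adj a' b ∧ col a' = i}.ncard =
      {a' | W'.Adj a' b ∧ c a' = i}.ncard + if z b = i then {a' | W.Adj a' b ∧ a' ∈ Z}.ncard else 0 := by
    intro i
    rw [← ncard_and_add_ncard_and_not _ (fun a' => a' ∈ Z), add_comm]
    congr 1
    · congr 1; ext a'
      simp only [Set.mem_ofPred_eq, hadj a' b hb, col]
      by_cases h : a' ∈ Z <;> simp [h]
    · split_ifs with hz
      · congr 1; ext a'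
        simp only [Set.mem_ofPred_eq, col]
        constructor
        · rintro ⟨⟨h1, -⟩, h2⟩; exact ⟨h1, h2⟩
        · rintro ⟨h1, h2⟩
          refine ⟨⟨h1, ?_⟩, h2⟩
          rw [if_pos h2, hnb a' h2 b h1, hz]
      · rw [Set.ncard_eq_zero]
        ext a'
        simp only [Set.mem_ofPred_eq, col, Set.mem_empty_iff_false, iff_false]
        rintro ⟨⟨h1, h3⟩, h2⟩
        rw [if_pos h2, hnb a' h2 b h1] at h3
        exact hz h3
  rw [hsplit]
  have hparb := hpar b hb
  by_cases haZ : a ∈ Z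
  · have hcol : col a = z b := by simp only [col, if_pos haZ, hnb a haZ b hab]
    rw [hZ a haZ, hcol, if_pos rfl]
    have : 0 < {a' | W.Adj a' b ∧ a' ∈ Z}.ncard := (Set.ncard_pos).2 ⟨a, hab, haZ⟩
    rw [even_iff_two_dvd] at hparb
    omega
  · have hcol : col a = c a := by simp only [col, if_neg haZ]
    have hodd : Odd {a' | W'.Adj a' b ∧ c a' = col a}.ncard := by
      rcases hc b hb (col a) with h | h
      · exfalso
        have : a ∈ {a' | W'.Adj a' b ∧ c a' = col a} := ⟨(hadj a b hb).2 ⟨hab, haZ⟩, hcol.symm⟩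
        rw [h] at this; exact this
      · exact h
    have hodd2 : Odd ({a' | W'.Adj a' b ∧ c a' = col a}.ncard +
        if z b = col a then {a' | W.Adj a' b ∧ a' ∈ Z}.ncard else 0) := by
      split_ifs
      · exact hodd.add_even hparb
      · simpa using hodd
    intro h
    rw [← h] at hodd2
    exact Nat.not_even_iff_odd.2 hodd2 (hev a ha haZ)

/-! ### Longest paths and the choice of `b₀` -/

theorem Reachable.eq_of_forall_not_adj {V : Type*} {G : SimpleGraph V} {x y : V}
    (h : G.Reachable x y) (hx : ∀ z, ¬ G.Adj x z) : x = y := by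
  obtain ⟨p⟩ := h
  cases p with
  | nil => rfl
  | cons h _ => exact absurd h (hx _)

theorem reachable_of_forall_adj_succ {V : Type*} {G : SimpleGraph V} {v : ℕ → V} {j k : ℕ}
    (hjk : j ≤ k) (h : ∀ l, j ≤ l → l < k → G.Adj (v l) (v (l + 1))) :
    G.Reachable (v j) (v k) := by
  induction k, hjk using Nat.le_induction with
  | base => exact Reachable.refl _
  | succ k hk ih =>
    exact (ih fun l h1 h2 => h l h1 (by omega)).trans (h k hk (by omega)).reachable

theorem exists_isAcyclic_path {V : Type*} (v : ℕ → V) (m : ℕ) (hv : Set.InjOn v {i | i ≤ m}) :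
    ∃ Q : SimpleGraph V, Q.IsAcyclic ∧ (∀ i < m, Q.Adj (v i) (v (i + 1))) ∧
      ∀ x y, Q.Adj x y → ∃ i < m, s(x, y) = s(v i, v (i + 1)) := by
  induction m with
  | zero => exact ⟨⊥, isAcyclic_bot, by simp, by simp⟩
  | succ m ih =>
    obtain ⟨Q, h1, h2, h3⟩ := ih (hv.mono fun i (hi : i ≤ m) => (by simp; omega))
    have hinj : ∀ i ≤ m, v i ≠ v (m + 1) := fun i hi h => by
      have := hv (show i ≤ m + 1 by omega) (show m + 1 ≤ m + 1 by omega) h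
      omega
    have hiso : ∀ z, ¬ Q.Adj (v (m + 1)) z := by
      intro z hz
      obtain ⟨i, hi, h⟩ := h3 _ _ hz
      rw [Sym2.eq_iff] at h
      rcases h with ⟨h, -⟩ | ⟨h, -⟩
      · exact hinj i (by omega) h.symm
      · exact hinj (i + 1) (by omega) h.symm
    refine ⟨Q ⊔ edge (v m) (v (m + 1)), h1.sup_edge_of_not_reachable fun h => ?_, ?_, ?_⟩
    · exact hinj m le_rfl (h.symm.eq_of_forall_not_adj hiso).symm
    · intro i hi
      rcases Nat.lt_succ_iff_lt_or_eq.1 hi with hi | rfl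
      · exact Or.inl (h2 i hi)
      · right
        rw [edge_adj]
        exact ⟨Or.inl ⟨rfl, rfl⟩, hinj i le_rfl⟩
    · intro x y h
      rcases h with h | h
      · obtain ⟨i, hi, h⟩ := h3 _ _ h
        exact ⟨i, by omega, h⟩
      · rw [edge_adj] at h
        exact ⟨m, by omega, Sym2.eq_iff.2 h.1⟩

/-- A longest path from `r` to a vertex outside `X`. -/
theorem exists_longest_path {G : SimpleGraph V} {X : Set V}
    (hX : ∀ ⦃v w⦄, G.Adj v w → (v ∈ X ↔ w ∉ X))
    (hev : ∀ a ∈ X, Even {b | G.Adj a b}.ncard) {r : V} (hr : r ∉ X) (hrx : ∃ x, G.Adj r x) :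
    ∃ (n : ℕ) (v : ℕ → V), 0 < n ∧ v n ∉ X ∧ Set.InjOn v {i | i ≤ n} ∧ v 0 = r ∧
      (∀ i < n, G.Adj (v i) (v (i + 1))) ∧
      ∀ a b, G.Adj (v n) a → (∀ i < n, v i ≠ a) → G.Adj a b → ∃ i ≤ n, v i = b := by
  classical
  have := Fintype.ofFinite V
  let L : Set ℕ := {n | ∃ b ∉ X, ∃ p : G.Walk r b, p.IsPath ∧ p.length = n}
  have hfin : L.Finite := (Set.finite_lt_nat (Fintype.card V)).subset (by
    rintro n ⟨b, -, p, hp, rfl⟩; exact hp.length_lt)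
  obtain ⟨n, ⟨b₀, hb₀, p, hp, hpn⟩, hmax⟩ := Set.exists_max_image L id hfin
    ⟨0, r, hr, Walk.nil, Walk.IsPath.nil, rfl⟩
  -- Otherwise the path could be prolonged by two edges to another vertex outside `X`.
  have hext : ∀ a b, G.Adj b₀ a → a ∉ p.support → G.Adj a b → b ∈ p.support := by
    intro a b h1 h2 h3
    by_contra h4
    have hbX : b ∉ X := by
      have := hX h1; have := hX h3; tauto
    have hp1 : (p.concat h1).IsPath := hp.concat h2 h1
    have hp2 : ((p.concat h1).concat h3).IsPath := hp1.concat (by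
      rw [Walk.support_concat]; simp [h4, h3.ne']) h3
    have := hmax _ ⟨b, hbX, _, hp2, rfl⟩
    simp [Walk.length_concat] at this
    omega
  have hmem : ∀ x, x ∈ p.support ↔ ∃ i ≤ n, p.getVert i = x := by
    intro x
    rw [Walk.mem_support_iff_exists_getVert, ← hpn]
    exact exists_congr fun i => and_comm
  have hn : p.getVert n = b₀ := hpn ▸ p.getVert_length
  refine ⟨n, p.getVert, ?_, by rwa [hn], hpn ▸ hp.getVert_injOn, p.getVert_zero,
    fun i hi => p.adj_getVert_succ (hpn ▸ hi), ?_⟩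
  -- If the longest path were trivial, a neighbor of `r` would have `r` as its only neighbor, hence
  -- odd degree.
  · rcases Nat.eq_zero_or_pos n with h0 | h0
    · exfalso
      obtain ⟨a, ha⟩ := hrx
      have hs : ∀ x ∈ p.support, x = r := by
        intro x hx
        obtain ⟨i, hi, rfl⟩ := (hmem x).1 hx
        obtain rfl : i = 0 := by omega
        exact p.getVert_zero
      have hbr : b₀ = r := hs _ p.end_mem_support
      have haX : a ∈ X := by have := hX ha; tauto
      have hev' := hev a haX
      have h1 : {b | G.Adj a b} ⊆ {r} := fun b hb =>
        hs b (hext a b (hbr ▸ ha) (fun h => ha.ne' (hs a h)) hb)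
      have h2 : {b | G.Adj a b} = {r} := h1.antisymm (by simpa using ha.symm)
      rw [h2] at hev'
      simp at hev'
    · exact h0
  · rw [hn]
    intro a b h1 h2 h3
    refine (hmem b).1 (hext a b h1 (fun h => ?_) h3)
    obtain ⟨i, hi, rfl⟩ := (hmem a).1 h
    rcases hi.lt_or_eq with hi | rfl
    · exact h2 i hi rfl
    · exact h1.ne hn.symm

/-- In a connected bipartite graph with even degrees in the part `X`, some vertex `b₀` of the other
part has a connected complement with a spanning tree in which the neighbors of `b₀` are
mostly spread out along a path. -/
theorem exists_vertex_spanning_tree {G : SimpleGraph V} {X : Set V}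
    (hX : ∀ ⦃v w⦄, G.Adj v w → (v ∈ X ↔ w ∉ X))
    (hev : ∀ a ∈ X, Even {b | G.Adj a b}.ncard)
    (hconn : ∀ v w, (∃ x, G.Adj v x) → (∃ x, G.Adj w x) → G.Reachable v w)
    (hne : ∃ r ∉ X, ∃ x, G.Adj r x) :
    ∃ b₀ ∉ X, (∃ x, G.Adj b₀ x) ∧ ∃ T ≤ G, T.IsAcyclic ∧ (∀ x, ¬ T.Adj b₀ x) ∧
      (∀ v w, v ≠ b₀ → w ≠ b₀ → (∃ x, G.Adj v x) → (∃ x, G.Adj w x) → T.Reachable v w) ∧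
      ∀ a, G.Adj b₀ a →
        {b | T.Adj a b ∧ ∃ a₂ ≠ a, G.Adj b₀ a₂ ∧ T.Adj a₂ b}.ncard ≤ 2 := by
  obtain ⟨r, hr, hrx⟩ := hne
  obtain ⟨n, v, hn, hvX, hinj, hv0, hadj, hclosed⟩ := exists_longest_path hX hev hr hrx
  obtain ⟨m, rfl⟩ : ∃ m, n = m + 1 := ⟨n - 1, by omega⟩
  set b₀ := v (m + 1) with hb₀
  have hvne : ∀ i ≤ m, v i ≠ b₀ := fun i hi h => by
    have := hinj (show i ≤ m + 1 by omega) (show m + 1 ≤ m + 1 by omega) h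
    omega
  obtain ⟨Q, hQ, hQadj, hQle⟩ := exists_isAcyclic_path v m
    (hinj.mono fun i (hi : i ≤ m) => (by simp; omega))
  set G₀ := G.deleteIncidenceSet b₀ with hG₀
  have hG₀adj : ∀ x y, G₀.Adj x y ↔ G.Adj x y ∧ x ≠ b₀ ∧ y ≠ b₀ := fun _ _ => deleteIncidenceSet_adj
  have hG₀v : ∀ i < m, G₀.Adj (v i) (v (i + 1)) := fun i hi =>
    (hG₀adj _ _).2 ⟨hadj i (by omega), hvne i hi.le, hvne _ hi⟩
  have hQG : Q ≤ G₀ := by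
    intro x y h
    obtain ⟨i, hi, h⟩ := hQle x y h
    rw [Sym2.eq_iff] at h
    rcases h with ⟨rfl, rfl⟩ | ⟨rfl, rfl⟩
    · exact hG₀v i hi
    · exact (hG₀v i hi).symm
  obtain ⟨T, hQT, hTG, hT, hreach⟩ := exists_isAcyclic_reachable_eq_le_of_le_of_isAcyclic hQG hQ
  have hTv : ∀ i < m, T.Adj (v i) (v (i + 1)) := fun i hi => hQT (hQadj i hi)
  have hpath : ∀ i ≤ m, G₀.Reachable r (v i) := fun i hi => by
    rw [← hv0]
    exact reachable_of_forall_adj_succ (Nat.zero_le i) fun l _ hl => hG₀v l (by omega)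
  have hnb : ∀ a, G.Adj b₀ a → (∀ i ≤ m, v i ≠ a) → ∀ b, G.Adj a b → b ≠ b₀ → ∃ i ≤ m, v i = b := by
    intro a ha hi b hb hbb
    obtain ⟨i, hi, rfl⟩ := hclosed a b ha (fun i h => hi i (by omega)) hb
    rcases hi.lt_or_eq with h | rfl
    · exact ⟨i, by omega, rfl⟩
    · exact absurd rfl hbb
  -- A neighbor of `b₀` off the path has even degree, so it has a neighbor other than `b₀`, which
  -- must be on the path; thus it stays connected to `r` without `b₀`.
  have hall : ∀ w, G.Reachable r w → w ≠ b₀ → G₀.Reachable r w := by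
    intro w hw
    rw [reachable_iff_reflTransGen] at hw
    induction hw with
    | refl => exact fun _ => Reachable.refl _
    | @tail x y _ hxy ih =>
      intro hy
      by_cases hx : x = b₀
      · subst hx
        by_cases hyv : ∃ i ≤ m, v i = y
        · obtain ⟨i, hi, rfl⟩ := hyv
          exact hpath i hi
        · push Not at hyv
          have hyX : y ∈ X := by have := hX hxy; tauto
          have : ∃ b, G.Adj y b ∧ b ≠ b₀ := by
            by_contra! hcon
            have h2 : {b | G.Adj y b} = {b₀} :=
              Set.Subset.antisymm (fun b hb => hcon b hb) (by simpa using hxy.symm)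
            have := hev y hyX
            rw [h2] at this
            simp at this
          obtain ⟨b, hyb, hbb⟩ := this
          obtain ⟨i, hi, rfl⟩ := hnb y hxy hyv b hyb hbb
          exact (hpath i hi).trans ((hG₀adj _ _).2 ⟨hyb.symm, hbb, hy⟩).reachable
      · exact (ih hx).trans ((hG₀adj _ _).2 ⟨hxy, hx, hy⟩).reachable
  have hTG' : ∀ x y, T.Adj x y → G.Adj x y ∧ x ≠ b₀ ∧ y ≠ b₀ := fun x y h => (hG₀adj x y).1 (hTG h)
  have hside : ∀ a j k, j ≤ k → k ≤ m → (∀ l, j ≤ l → l ≤ k → v l ≠ a) →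
      T.Adj (v j) a → T.Adj (v k) a → j = k := by
    intro a j k hjk hkm hl hj hk
    refine hinj (show j ≤ m + 1 by omega) (show k ≤ m + 1 by omega)
      (hT.eq_of_adj_of_reachable hj hk (reachable_of_forall_adj_succ hjk fun l h1 h2 => ?_))
    exact deleteIncidenceSet_adj.2 ⟨hTv l (by omega), hl l h1 h2.le, hl _ (by omega) h2⟩
  -- If `b` were off the path, then `a` and `a₂` would be on it, and the stretch between them would
  -- close a cycle in `T` through `b`.
  have hbad : ∀ a b, G.Adj b₀ a → T.Adj a b → (∃ a₂ ≠ a, G.Adj b₀ a₂ ∧ T.Adj a₂ b) →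
      ∃ i ≤ m, v i = b := by
    rintro a b ha hab ⟨a₂, hne, ha₂, hab₂⟩
    by_contra! hb
    have h1 : ∃ i ≤ m, v i = a := by
      by_contra! h
      obtain ⟨i, hi, h⟩ := hnb a ha h b (hTG' _ _ hab).1 (hTG' _ _ hab).2.2
      exact hb i hi h
    have h2 : ∃ i ≤ m, v i = a₂ := by
      by_contra! h
      obtain ⟨i, hi, h⟩ := hnb a₂ ha₂ h b (hTG' _ _ hab₂).1 (hTG' _ _ hab₂).2.2
      exact hb i hi h
    obtain ⟨i, hi, rfl⟩ := h1
    obtain ⟨j, hj, rfl⟩ := h2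
    rcases le_total i j with hij | hij
    · exact hne (congrArg v (hside b i j hij hj (fun l _ _ => hb l (by omega)) hab hab₂).symm)
    · exact hne (congrArg v (hside b j i hij hi (fun l _ _ => hb l (by omega)) hab₂ hab))
  refine ⟨b₀, hvX, ⟨v m, (hadj m (by omega)).symm⟩, T, fun x y h => (hTG' x y h).1, hT,
    fun x h => (hTG' _ _ h).2.1 rfl, ?_, ?_⟩
  · intro x y hx hy hx' hy'
    rw [hreach]
    exact (hall x (hconn r x hrx hx') hx).symm.trans (hall y (hconn r y hrx hy') hy)
  · intro a ha
    by_contra! hcard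
    obtain ⟨x, hx, y, hy, z, hz, hxy, hxz, hyz⟩ := (Set.two_lt_ncard (Set.toFinite _)).1 hcard
    have key : ∀ b, b ∈ {b | T.Adj a b ∧ ∃ a₂ ≠ a, G.Adj b₀ a₂ ∧ T.Adj a₂ b} →
        ∃ i ≤ m, v i = b ∧ T.Adj (v i) a := by
      rintro b ⟨h1, h2⟩
      obtain ⟨i, hi, rfl⟩ := hbad a b ha h1 h2
      exact ⟨i, hi, rfl, h1.symm⟩
    obtain ⟨i, hi, rfl, hia⟩ := key x hx
    obtain ⟨j, hj, rfl, hja⟩ := key y hy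
    obtain ⟨k, hk, rfl, hka⟩ := key z hz
    have hij : i ≠ j := fun h => hxy (congrArg v h)
    have hik : i ≠ k := fun h => hxz (congrArg v h)
    have hjk : j ≠ k := fun h => hyz (congrArg v h)
    -- Two path vertices adjacent to `a` in `T` have `a` between them on the path, by acyclicity.
    -- Three of them would make `a` occur twice.
    have sep : ∀ p q, p ≤ m → q ≤ m → p < q → T.Adj (v p) a → T.Adj (v q) a →
        ∃ l, p < l ∧ l < q ∧ v l = a := by
      intro p q hp hq hpq hpa hqa
      by_contra! h
      refine hpq.ne (hside a p q hpq.le hq (fun l h1 h2 => ?_) hpa hqa)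
      rcases h1.eq_or_lt with rfl | h1
      · exact hpa.ne
      rcases h2.eq_or_lt with rfl | h2
      · exact hqa.ne
      exact h l h1 h2
    have huniq : ∀ l l', l ≤ m → l' ≤ m → v l = a → v l' = a → l = l' := fun l l' h h' e e' =>
      hinj (show l ≤ m + 1 by omega) (show l' ≤ m + 1 by omega) (e.trans e'.symm)
    have three : ∀ p q s, p ≤ m → q ≤ m → s ≤ m → p < q → q < s → T.Adj (v p) a → T.Adj (v q) a →
        T.Adj (v s) a → False := by
      intro p q s hp hq hs hpq hqs hpa hqa hsa
      obtain ⟨l, h1, h2, h3⟩ := sep p q hp hq hpq hpa hqa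
      obtain ⟨l', h1', h2', h3'⟩ := sep q s hq hs hqs hqa hsa
      have := huniq l l' (by omega) (by omega) h3 h3'
      omega
    rcases lt_or_gt_of_ne hij with h1 | h1 <;> rcases lt_or_gt_of_ne hik with h2 | h2 <;>
      rcases lt_or_gt_of_ne hjk with h3 | h3
    · exact three i j k hi hj hk h1 h3 hia hja hka
    · exact three i k j hi hk hj h2 h3 hia hka hja
    · omega
    · exact three k i j hk hi hj h2 h1 hka hia hja
    · exact three j i k hj hi hk h1 h2 hja hia hka
    · omega
    · exact three j k i hj hk hi h3 h2 hja hka hia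
    · exact three k j i hk hj hi h3 h1 hka hja hia

/-! ### Four-colorings from decompositions -/

/-- The edges of the bipartite graph `G` with part `X` can be colored with four colors such that
the two ends of every edge have distinct degrees in the color of that edge. Edges are written as
pairs whose first component is in `X`. -/
def HasFourColoringFrom {V : Type*} (G : SimpleGraph V) (X : Set V) : Prop :=
  ∃ col : V → V → Fin 4, ∀ a ∈ X, ∀ b, G.Adj a b →
    {b' | G.Adj a b' ∧ col a b' = col a b}.ncard ≠ {a' | G.Adj a' b ∧ col a' b = col a b}.ncard

/-- A four-coloring from a decomposition into a graph in which exactly the degrees in `X` are even,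
a locally irregular graph `S`, and a forest `W` with few odd degrees in `X`. -/
theorem hasFourColoringFrom_of_decomposition {G W : SimpleGraph V} {X Z : Set V}
    {U S : V → V → Prop}
    (hX : ∀ ⦃v w⦄, G.Adj v w → (v ∈ X ↔ w ∉ X))
    (hU : ∀ a b, U a b → G.Adj a b ∧ a ∈ X)
    (hHX : ∀ a ∈ X, Even {b | G.Adj a b ∧ ¬ U a b}.ncard)
    (hHY : ∀ b ∉ X, (∃ a, G.Adj a b ∧ ¬ U a b) → Odd {a | G.Adj a b ∧ ¬ U a b}.ncard)
    (hSU : ∀ a b, S a b → U a b)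
    (hS : ∀ a b, S a b → {b' | S a b'}.ncard ≠ {a' | S a' b}.ncard)
    (hW : W.IsAcyclic) (hWX : ∀ ⦃v w⦄, W.Adj v w → (v ∈ X ↔ w ∉ X))
    (hWU : ∀ a ∈ X, ∀ b, W.Adj a b ↔ U a b ∧ ¬ S a b)
    (hZX : Z ⊆ X)
    (hZ : ∀ a ∈ Z, {b | W.Adj a b}.ncard = 1)
    (hev : ∀ a ∈ X, a ∉ Z → Even {b | W.Adj a b}.ncard)
    (hpar : ∀ b ∉ X, Even {a | W.Adj a b ∧ a ∈ Z}.ncard) :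
    G.HasFourColoringFrom X := by
  classical
  obtain ⟨c, hc⟩ := hW.exists_two_coloring_of_leaves hWX hZX hZ hev hpar
  -- Color 3 is `S`, color 0 is the complement of `U`, and colors 1 and 2 split `W` according to the
  -- end in `X`.
  let col : V → V → Fin 4 := fun a b =>
    if S a b then 3 else if U a b then (if c a then 1 else 2) else 0
  have h3 : ∀ a b, col a b = 3 ↔ S a b := by
    intro a b
    simp only [col]
    split_ifs <;> simp_all
  have h0 : ∀ a b, col a b = 0 ↔ ¬ U a b := by
    intro a b
    have := hSU a b
    simp only [col]
    split_ifs <;> simp_all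
  have h12 : ∀ a b i, col a b = (if i = true then 1 else 2) ↔ (U a b ∧ ¬ S a b) ∧ c a = i := by
    intro a b i
    have := hSU a b
    simp only [col]
    cases i <;> split_ifs <;> simp_all
  refine ⟨col, fun a ha b hab => ?_⟩
  have hb : b ∉ X := (hX hab).1 ha
  by_cases hs : S a b
  · rw [(h3 a b).2 hs]
    simp only [h3]
    have e1 : ∀ x y, (G.Adj x y ∧ S x y) = S x y := fun x y =>
      propext ⟨fun h => h.2, fun h => ⟨(hU _ _ (hSU _ _ h)).1, h⟩⟩
    simp only [e1]
    exact hS a b hs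
  by_cases hu : U a b
  · rw [(h12 a b (c a)).2 ⟨⟨hu, hs⟩, rfl⟩]
    simp only [h12]
    have e1 : {b' | G.Adj a b' ∧ (U a b' ∧ ¬ S a b') ∧ True} = {b' | W.Adj a b'} := by
      ext b'
      simp only [Set.mem_ofPred_eq, hWU a ha, and_true]
      exact ⟨fun h => h.2, fun h => ⟨(hU _ _ h.1).1, h⟩⟩
    have e2 : {a' | G.Adj a' b ∧ (U a' b ∧ ¬ S a' b) ∧ c a' = c a} =
        {a' | W.Adj a' b ∧ c a' = c a} := by
      ext a'
      simp only [Set.mem_ofPred_eq]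
      constructor
      · rintro ⟨h1, h2, h3⟩
        exact ⟨(hWU a' (hU _ _ h2.1).2 b).2 h2, h3⟩
      · rintro ⟨h1, h2⟩
        have h4 := (hWU a' ((hWX h1).2 hb) b).1 h1
        exact ⟨(hU _ _ h4.1).1, h4, h2⟩
    rw [e1, e2]
    exact hc a ha b ((hWU a ha b).2 ⟨hu, hs⟩)
  · rw [(h0 a b).2 hu]
    simp only [h0]
    intro h
    have := hHY b hb ⟨a, hab, hu⟩
    rw [← h] at this
    exact Nat.not_even_iff_odd.2 this (hHX a ha)

/-- The case in which evenly many vertices of the second part have even degree. -/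
theorem hasFourColoringFrom_of_even {G : SimpleGraph V} {X : Set V}
    (hX : ∀ ⦃v w⦄, G.Adj v w → (v ∈ X ↔ w ∉ X))
    (hev : ∀ a ∈ X, Even {b | G.Adj a b}.ncard)
    (hconn : ∀ v w, (∃ x, G.Adj v x) → (∃ x, G.Adj w x) → G.Reachable v w)
    (hE : Even {b | b ∉ X ∧ (∃ x, G.Adj b x) ∧ Even {a | G.Adj b a}.ncard}.ncard) :
    G.HasFourColoringFrom X := by
  obtain ⟨T, hTG, hT, hreach⟩ := G.exists_isAcyclic_reachable_eq_le
  obtain ⟨F, hFT, hF⟩ := T.exists_le_odd_degree_iff_mem _ hE fun v hv w hw => by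
    rw [hreach]; exact hconn v w hv.2.1 hw.2.1
  have hFG := hFT.trans hTG
  have hFX : ∀ a ∈ X, Even {b | F.Adj a b}.ncard := fun a ha => by
    rw [← Nat.not_odd_iff_even, hF]
    exact fun h => h.1 ha
  have hsplit : ∀ v, {w | F.Adj v w}.ncard + {w | G.Adj v w ∧ ¬ F.Adj v w}.ncard =
      {w | G.Adj v w}.ncard := fun v => by
    rw [← ncard_and_add_ncard_and_not (G.Adj v) (F.Adj v)]
    congr 2; ext w
    exact ⟨fun h => ⟨hFG h, h⟩, fun h => h.2⟩
  refine hasFourColoringFrom_of_decomposition (W := F) (Z := ∅) (S := fun _ _ => False)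
    (U := fun a b => F.Adj a b ∧ a ∈ X) hX (fun a b h => ⟨hFG h.1, h.2⟩) ?_ ?_ (by simp) (by simp)
    (hT.anti hFT) (fun v w h => hX (hFG h)) (by simp +contextual) (by simp) (by simp)
    (fun a ha _ => hFX a ha) (by simp)
  · intro a ha
    have h1 := hsplit a
    have h2 := hFX a ha
    have h3 := hev a ha
    simp only [ha, and_true]
    rw [← h1, Nat.even_add] at h3
    exact h3.1 h2
  · rintro b hb ⟨a, ha, -⟩
    have h1 := hsplit b
    have h2 := hF b
    have e : {a | G.Adj a b ∧ ¬ (F.Adj a b ∧ a ∈ X)} = {a | G.Adj b a ∧ ¬ F.Adj b a} := by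
      ext x
      simp only [Set.mem_ofPred_eq, G.adj_comm x b, F.adj_comm x b]
      refine and_congr_right fun h => not_congr (and_iff_left ?_)
      have := hX h; tauto
    rw [e]
    have h3 : (Odd {w | F.Adj b w}.ncard ↔ Even {w | G.Adj b w}.ncard) :=
      h2.trans ⟨fun h => h.2.2, fun h => ⟨hb, ⟨a, ha.symm⟩, h⟩⟩
    rw [← h1] at h3
    grind

/-! ### The odd case -/

/-- The case of few neighbors of `b₀`: one path of length two is colored separately. -/
theorem exists_decomposition_of_degree_le_two {G F : SimpleGraph V} {X : Set V} {b₀ : V}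
    {U : V → V → Prop}
    (hX : ∀ ⦃v w⦄, G.Adj v w → (v ∈ X ↔ w ∉ X)) (hb₀ : b₀ ∉ X)
    (hFG : F ≤ G) (hF : F.IsAcyclic) (hFb : ∀ x, ¬ F.Adj b₀ x)
    (hFN : ∀ a, G.Adj b₀ a → ∃ b, F.Adj a b)
    (hU : ∀ a b, U a b ↔ a ∈ X ∧ (F.Adj a b ∨ b = b₀ ∧ G.Adj b₀ a))
    (hUX : ∀ a ∈ X, Even {b | U a b}.ncard)
    (hpos : ∃ a, G.Adj b₀ a) (hd : {a | G.Adj b₀ a}.ncard ≤ 2) :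
    ∃ (W : SimpleGraph V) (S : V → V → Prop), W.IsAcyclic ∧
      (∀ ⦃v w⦄, W.Adj v w → (v ∈ X ↔ w ∉ X)) ∧
      (∀ a ∈ X, ∀ b, W.Adj a b ↔ U a b ∧ ¬ S a b) ∧
      (∀ a b, S a b → U a b) ∧
      (∀ a b, S a b → {b' | S a b'}.ncard ≠ {a' | S a' b}.ncard) ∧
      ∀ a ∈ X, Even {b | W.Adj a b}.ncard := by
  obtain ⟨m, hm⟩ := hpos
  obtain ⟨f, hf⟩ := hFN m hm
  have hNX : ∀ a, G.Adj b₀ a → a ∈ X := fun a h => by have := hX h; tauto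
  have hfb : f ≠ b₀ := fun h => hFb m (h ▸ hf.symm)
  -- `n` is the other neighbor of `b₀`, or `m` by default. At most the edge `b₀n` of the star is
  -- left for `W`; as `b₀` is isolated in `F`, adding it creates no cycle.
  have hn : ∃ n, G.Adj b₀ n ∧ ∀ a, G.Adj b₀ a → a ≠ m → a = n := by
    by_cases h : ∃ n, G.Adj b₀ n ∧ n ≠ m
    · obtain ⟨n, hn, hnm⟩ := h
      refine ⟨n, hn, fun a ha ham => ?_⟩
      by_contra han
      have := (Set.two_lt_ncard (s := {a | G.Adj b₀ a}) (Set.toFinite _)).2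
        ⟨m, hm, n, hn, a, ha, hnm.symm, ham.symm, Ne.symm han⟩
      omega
    · push Not at h
      exact ⟨m, hm, fun a ha ham => absurd (h a ha) ham⟩
  obtain ⟨n, hn, hnuniq⟩ := hn
  let S : V → V → Prop := fun a b => a = m ∧ (b = b₀ ∨ b = f)
  have hUadj : ∀ a b, U a b → G.Adj a b := by
    intro a b h
    rcases ((hU a b).1 h).2 with h | ⟨rfl, h⟩
    exacts [hFG h, h.symm]
  have hUX' : ∀ a b, U a b → a ∈ X ∧ b ∉ X := fun a b h =>
    ⟨((hU a b).1 h).1, (hX (hUadj a b h)).1 ((hU a b).1 h).1⟩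
  have hSU : ∀ a b, S a b → U a b := by
    rintro a b ⟨rfl, rfl | rfl⟩
    · exact (hU _ _).2 ⟨hNX _ hm, Or.inr ⟨rfl, hm⟩⟩
    · exact (hU _ _).2 ⟨hNX _ hm, Or.inl hf⟩
  let W : SimpleGraph V := ⟨fun v w => (U v w ∧ ¬ S v w) ∨ (U w v ∧ ¬ S w v),
    ⟨fun v w h => h.symm⟩, ⟨fun v h => by
      rcases h with h | h <;> exact (hUX' _ _ h.1).2 (hUX' _ _ h.1).1⟩⟩
  have hWU : ∀ a ∈ X, ∀ b, W.Adj a b ↔ U a b ∧ ¬ S a b := fun a ha b =>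
    ⟨fun h => h.resolve_right fun h => (hUX' _ _ h.1).2 ha, Or.inl⟩
  have hSm : {b | S m b} = {b₀, f} := by ext b; simp [S]
  have hR : ∀ v w, U v w ∧ ¬ S v w → (F ⊔ edge b₀ n).Adj v w := by
    rintro v w ⟨h1, h2⟩
    rcases ((hU v w).1 h1).2 with h | ⟨rfl, h⟩
    · exact Or.inl h
    · right
      have hvm : v ≠ m := fun hvm => h2 ⟨hvm, Or.inl rfl⟩
      have hvn := hnuniq v h hvm
      rw [edge_adj]
      exact ⟨Or.inr ⟨hvn, rfl⟩, h.ne'⟩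
  refine ⟨W, S, ?_, ?_, hWU, hSU, ?_, ?_⟩
  · refine (hF.sup_edge_of_not_reachable (u := b₀) (v := n) fun h => ?_).anti fun v w h => ?_
    · exact hn.ne (h.eq_of_forall_not_adj hFb)
    · rcases h with h | h
      · exact hR v w h
      · exact (hR w v h).symm
  · rintro v w (h | h)
    · have := hUX' _ _ h.1; tauto
    · have := hUX' _ _ h.1; tauto
  · intro a b h
    have h1 : {a' | S a' b} = {m} := by
      ext a'
      exact ⟨fun h' => h'.1, fun h' => ⟨h', h.2⟩⟩
    rw [h1, h.1, hSm, Set.ncard_pair hfb.symm, Set.ncard_singleton]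
    decide
  · intro a ha
    have h1 := ncard_and_add_ncard_and_not (U a) (S a)
    have h2 := hUX a ha
    simp only [hWU a ha]
    rw [← h1, Nat.even_add] at h2
    refine h2.1 ?_
    have e : {b | U a b ∧ S a b} = {b | S a b} := by
      ext b; exact ⟨fun h => h.2, fun h => ⟨hSU _ _ h, h⟩⟩
    rw [e]
    by_cases ham : a = m
    · rw [ham, hSm, Set.ncard_pair hfb.symm]
      exact even_two
    · have : {b | S a b} = ∅ := by
        ext b; simp [S, ham]
      simp [this]

/-- The case of many neighbors of `b₀`: the star at `b₀` is colored separately, and each of its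
leaves may be extended by one edge. -/
theorem exists_decomposition_of_two_lt_degree {G F : SimpleGraph V} {X : Set V} {b₀ : V}
    {U : V → V → Prop}
    (hX : ∀ ⦃v w⦄, G.Adj v w → (v ∈ X ↔ w ∉ X)) (hb₀ : b₀ ∉ X)
    (hFG : F ≤ G) (hF : F.IsAcyclic) (hFb : ∀ x, ¬ F.Adj b₀ x)
    (hFN : ∀ a, G.Adj b₀ a → ∃ b, F.Adj a b ∧ ({b | F.Adj a b}.ncard = 1 ∨
      {b | F.Adj a b}.ncard ≠ 1 ∧ ∀ a₂, G.Adj b₀ a₂ → F.Adj a₂ b → a₂ = a))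
    (hU : ∀ a b, U a b ↔ a ∈ X ∧ (F.Adj a b ∨ b = b₀ ∧ G.Adj b₀ a))
    (hUX : ∀ a ∈ X, Even {b | U a b}.ncard)
    (hd : 2 < {a | G.Adj b₀ a}.ncard) :
    ∃ (W : SimpleGraph V) (S : V → V → Prop) (Z : Set V), W.IsAcyclic ∧
      (∀ ⦃v w⦄, W.Adj v w → (v ∈ X ↔ w ∉ X)) ∧
      (∀ a ∈ X, ∀ b, W.Adj a b ↔ U a b ∧ ¬ S a b) ∧
      (∀ a b, S a b → U a b) ∧
      (∀ a b, S a b → {b' | S a b'}.ncard ≠ {a' | S a' b}.ncard) ∧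
      Z ⊆ X ∧ (∀ a ∈ Z, {b | W.Adj a b}.ncard = 1) ∧
      (∀ a ∈ X, a ∉ Z → Even {b | W.Adj a b}.ncard) ∧
      ∀ b ∉ X, Even {a | W.Adj a b ∧ a ∈ Z}.ncard := by
  have hNX : ∀ a, G.Adj b₀ a → a ∈ X := fun a h => by have := hX h; tauto
  have hf' : ∀ a, ∃ b, G.Adj b₀ a → F.Adj a b ∧ ({b | F.Adj a b}.ncard = 1 ∨
      {b | F.Adj a b}.ncard ≠ 1 ∧ ∀ a₂, G.Adj b₀ a₂ → F.Adj a₂ b → a₂ = a) := by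
    intro a
    by_cases h : G.Adj b₀ a
    · obtain ⟨b, hb⟩ := hFN a h
      exact ⟨b, fun _ => hb⟩
    · exact ⟨a, fun h' => absurd h' h⟩
  choose f hf using hf'
  have hfb : ∀ a, G.Adj b₀ a → f a ≠ b₀ := fun a ha h => hFb a (h ▸ (hf a ha).1.symm)
  let L : V → Prop := fun a => G.Adj b₀ a ∧ {b | F.Adj a b}.ncard = 1
  have hLf : ∀ a b, L a → F.Adj a b → f a = b := by
    rintro a b ⟨h1, h2⟩ h3
    obtain ⟨x, hx⟩ := Set.ncard_eq_one.1 h2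
    have h4 : f a ∈ ({x} : Set V) := hx ▸ (hf a h1).1
    have h5 : b ∈ ({x} : Set V) := hx ▸ h3
    exact h4.trans h5.symm
  -- Leaves of `F` in `N(b₀)` are grouped by their `F`-neighbor. Groups of even size stay in `W`;
  -- those of odd size are moved to `S`, where `f a` then has odd degree while `a` has degree 2.
  let Z : Set V := {a | L a ∧ Even {a' | L a' ∧ F.Adj a' (f a)}.ncard}
  let S : V → V → Prop := fun a b => G.Adj b₀ a ∧ (b = b₀ ∨ a ∉ Z ∧ b = f a)
  have hUadj : ∀ a b, U a b → G.Adj a b := by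
    intro a b h
    rcases ((hU a b).1 h).2 with h | ⟨rfl, h⟩
    exacts [hFG h, h.symm]
  have hUX' : ∀ a b, U a b → a ∈ X ∧ b ∉ X := fun a b h =>
    ⟨((hU a b).1 h).1, (hX (hUadj a b h)).1 ((hU a b).1 h).1⟩
  have hSU : ∀ a b, S a b → U a b := by
    rintro a b ⟨h, rfl | ⟨-, rfl⟩⟩
    · exact (hU _ _).2 ⟨hNX _ h, Or.inr ⟨rfl, h⟩⟩
    · exact (hU _ _).2 ⟨hNX _ h, Or.inl (hf a h).1⟩
  let W : SimpleGraph V := ⟨fun v w => (U v w ∧ ¬ S v w) ∨ (U w v ∧ ¬ S w v),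
    ⟨fun v w h => h.symm⟩, ⟨fun v h => by
      rcases h with h | h <;> exact (hUX' _ _ h.1).2 (hUX' _ _ h.1).1⟩⟩
  have hWU : ∀ a ∈ X, ∀ b, W.Adj a b ↔ U a b ∧ ¬ S a b := fun a ha b =>
    ⟨fun h => h.resolve_right fun h => (hUX' _ _ h.1).2 ha, Or.inl⟩
  have hR : ∀ v w, U v w ∧ ¬ S v w → F.Adj v w := by
    rintro v w ⟨h1, h2⟩
    rcases ((hU v w).1 h1).2 with h | ⟨rfl, h⟩
    · exact h
    · exact absurd ⟨h, Or.inl rfl⟩ h2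
  have hWF : W ≤ F := by
    rintro v w (h | h)
    · exact hR v w h
    · exact (hR w v h).symm
  have hSZ : ∀ a ∈ Z, {b | S a b} = {b₀} := by
    intro a ha
    ext b
    simp only [S, ha, ha.1.1, not_true_eq_false, false_and, or_false, true_and, Set.mem_ofPred_eq,
      Set.mem_singleton_iff]
  have hSN : ∀ a, G.Adj b₀ a → a ∉ Z → {b | S a b} = {b₀, f a} := by
    intro a ha hZ
    ext b
    simp only [S, hZ, ha, not_false_eq_true, true_and, Set.mem_ofPred_eq, Set.mem_insert_iff,
      Set.mem_singleton_iff]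
  have hZX : Z ⊆ X := fun a ha => hNX a ha.1.1
  have hWZ : ∀ a ∈ Z, ∀ b, W.Adj a b ↔ F.Adj a b := by
    intro a ha b
    refine ⟨fun h => hWF h, fun h => (hWU a (hZX ha) b).2 ⟨(hU a b).2 ⟨hZX ha, Or.inl h⟩, ?_⟩⟩
    intro hs
    have : b ∈ ({b₀} : Set V) := hSZ a ha ▸ hs
    rw [Set.mem_singleton_iff] at this
    exact hFb a (this ▸ h.symm)
  refine ⟨W, S, Z, hF.anti hWF, fun v w h => hX (hFG (hWF h)), hWU, hSU, ?_, hZX, ?_, ?_, ?_⟩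
  · rintro a b ⟨ha, hab⟩
    by_cases hb : b = b₀
    · have h1 : {a' | S a' b} = {a | G.Adj b₀ a} := by
        ext a'
        exact ⟨fun h => h.1, fun h => ⟨h, Or.inl hb⟩⟩
      -- Here `hd` is decisive: the center has degree more than 2 in `S`, and each of its neighbors
      -- at most 2.
      have h2 : {b' | S a b'}.ncard ≤ 2 := by
        by_cases hZ : a ∈ Z
        · rw [hSZ a hZ]; simp
        · rw [hSN a ha hZ, Set.ncard_pair (hfb a ha).symm]
      rw [h1]
      omega
    · obtain ⟨haZ, rfl⟩ := hab.resolve_left hb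
      rw [hSN a ha haZ, Set.ncard_pair (hfb a ha).symm]
      have hset : ∀ a', S a' (f a) ↔ G.Adj b₀ a' ∧ a' ∉ Z ∧ f a = f a' := by
        intro a'
        simp only [S, hb, false_or]
      rcases (hf a ha).2 with h1 | ⟨-, h1⟩
      · have hLa : L a := ⟨ha, h1⟩
        have hodd : ¬ Even {a' | L a' ∧ F.Adj a' (f a)}.ncard := fun h => haZ ⟨hLa, h⟩
        have e : {a' | S a' (f a)} = {a' | L a' ∧ F.Adj a' (f a)} := by
          ext a'
          simp only [Set.mem_ofPred_eq, hset]
          constructor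
          · rintro ⟨h2, h3, h4⟩
            refine ⟨⟨h2, ?_⟩, h4 ▸ (hf a' h2).1⟩
            rcases (hf a' h2).2 with h5 | ⟨-, h5⟩
            · exact h5
            · exact h5 a ha (h4 ▸ (hf a ha).1) ▸ h1
          · rintro ⟨h2, h3⟩
            have h4 := hLf a' _ h2 h3
            exact ⟨h2.1, fun hz => hodd (h4 ▸ hz.2), h4.symm⟩
        rw [e]
        intro h
        rw [← h] at hodd
        exact hodd even_two
      · have e : {a' | S a' (f a)} = {a} := by
          ext a'
          rw [Set.mem_ofPred_eq, hset]
          constructor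
          · rintro ⟨h2, h3, h4⟩
            exact h1 a' h2 (h4 ▸ (hf a' h2).1)
          · rintro rfl
            exact ⟨ha, haZ, rfl⟩
        rw [e]; simp
  · intro a ha
    simp only [hWZ a ha]
    exact ha.1.2
  · intro a ha haZ
    have h1 := ncard_and_add_ncard_and_not (U a) (S a)
    have h2 := hUX a ha
    simp only [hWU a ha]
    rw [← h1, Nat.even_add] at h2
    refine h2.1 ?_
    have e : {b | U a b ∧ S a b} = {b | S a b} := by
      ext b; exact ⟨fun h => h.2, fun h => ⟨hSU _ _ h, h⟩⟩
    rw [e]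
    by_cases haN : G.Adj b₀ a
    · rw [hSN a haN haZ, Set.ncard_pair (hfb a haN).symm]
      exact even_two
    · have : {b | S a b} = ∅ := by
        ext b; simp [S, haN]
      simp [this]
  · intro b hb
    by_cases hne : ∃ a ∈ Z, F.Adj a b
    · obtain ⟨a, ha, hab⟩ := hne
      have h1 := hLf a b ha.1 hab
      have h2 := ha.2
      rw [h1] at h2
      convert! h2 using 2
      ext a'
      constructor
      · rintro ⟨h3, h4⟩
        exact ⟨h4.1, hWF h3⟩
      · rintro ⟨h3, h4⟩
        have hZ' : a' ∈ Z := ⟨h3, by rw [hLf a' b h3 h4]; exact h2⟩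
        exact ⟨(hWZ a' hZ' b).2 h4, hZ'⟩
    · have : {a | W.Adj a b ∧ a ∈ Z} = ∅ := by
        ext a
        simp only [Set.mem_ofPred_eq, Set.mem_empty_iff_false, iff_false]
        rintro ⟨h1, h2⟩
        exact hne ⟨a, h2, hWF h1⟩
      simp [this]

/-- The star at `b₀` removes the parity obstruction: it makes `b₀` isolated outside `U`, and odd
`F`-degrees on `N(b₀)` compensate for its edges. -/
theorem hasFourColoringFrom_of_odd {G : SimpleGraph V} {X : Set V}
    (hX : ∀ ⦃v w⦄, G.Adj v w → (v ∈ X ↔ w ∉ X))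
    (hev : ∀ a ∈ X, Even {b | G.Adj a b}.ncard)
    (hconn : ∀ v w, (∃ x, G.Adj v x) → (∃ x, G.Adj w x) → G.Reachable v w)
    (hO : Odd {b | b ∉ X ∧ (∃ x, G.Adj b x) ∧ Even {a | G.Adj b a}.ncard}.ncard) :
    G.HasFourColoringFrom X := by
  set E : Set V := {b | b ∉ X ∧ (∃ x, G.Adj b x) ∧ Even {a | G.Adj b a}.ncard} with hE
  obtain ⟨r, hr⟩ := (Set.ncard_pos (Set.toFinite E)).1 hO.pos
  obtain ⟨b₀, hb₀, hpos, T, hTG, hT, hTb, hreach, hbad⟩ :=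
    exists_vertex_spanning_tree hX hev hconn ⟨r, hr.1, hr.2.1⟩
  have hNX : ∀ a, G.Adj b₀ a → a ∈ X := fun a h => by have := hX h; tauto
  have hdisj : Disjoint {a | G.Adj b₀ a} (E \ {b₀}) :=
    Set.disjoint_left.2 fun a h1 h2 => h2.1.1 (hNX a h1)
  -- If `b₀ ∈ E`, both sets have even size; otherwise both have odd size.
  have heven : Even ({a | G.Adj b₀ a} ∪ E \ {b₀}).ncard := by
    rw [Set.ncard_union_eq hdisj]
    by_cases hbE : b₀ ∈ E
    · have h1 := Set.ncard_sdiff_singleton_add_one hbE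
      rw [← h1] at hO
      have h2 := hbE.2.2
      grind
    · have h1 : E \ {b₀} = E := Set.sdiff_singleton_eq_self hbE
      rw [h1]
      have h2 : ¬ Even {a | G.Adj b₀ a}.ncard := fun h => hbE ⟨hb₀, hpos, h⟩
      grind
  have hmem : ∀ v ∈ {a | G.Adj b₀ a} ∪ E \ {b₀}, v ≠ b₀ ∧ ∃ x, G.Adj v x := by
    rintro v (h | h)
    · exact ⟨h.ne', b₀, h.symm⟩
    · exact ⟨h.2, h.1.2.1⟩
  obtain ⟨F, hFT, hFodd⟩ := T.exists_le_odd_degree_iff_mem _ heven fun v hv w hw =>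
    hreach v w (hmem v hv).1 (hmem w hw).1 (hmem v hv).2 (hmem w hw).2
  have hFG := hFT.trans hTG
  have hFb : ∀ x, ¬ F.Adj b₀ x := fun x h => hTb x (hFT h)
  have hFa := hT.anti hFT
  let U : V → V → Prop := fun a b => a ∈ X ∧ (F.Adj a b ∨ b = b₀ ∧ G.Adj b₀ a)
  have hU : ∀ a b, U a b ↔ a ∈ X ∧ (F.Adj a b ∨ b = b₀ ∧ G.Adj b₀ a) := fun _ _ => Iff.rfl
  have hUG : ∀ a b, U a b → G.Adj a b ∧ a ∈ X := by
    rintro a b ⟨h1, h | ⟨rfl, h⟩⟩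
    exacts [⟨hFG h, h1⟩, ⟨h.symm, h1⟩]
  have hUX : ∀ a ∈ X, Even {b | U a b}.ncard := by
    intro a ha
    by_cases hab : G.Adj b₀ a
    · have e : {b | U a b} = insert b₀ {b | F.Adj a b} := by
        ext b
        simp only [Set.mem_ofPred_eq, hU, ha, hab, and_true, true_and, Set.mem_insert_iff, or_comm]
      rw [e, Set.ncard_insert_of_notMem fun h => hFb a h.symm, Nat.even_add_one,
        Nat.not_even_iff_odd]
      exact (hFodd a).2 (Or.inl hab)
    · have e : {b | U a b} = {b | F.Adj a b} := by
        ext b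
        simp only [Set.mem_ofPred_eq, hU, ha, hab, and_false, true_and, or_false]
      rw [e, ← Nat.not_odd_iff_even, hFodd a]
      rintro (h | h)
      exacts [hab h, h.1.1 ha]
  have hsplit : ∀ a, {b | U a b}.ncard + {b | G.Adj a b ∧ ¬ U a b}.ncard = {b | G.Adj a b}.ncard := by
    intro a
    rw [← ncard_and_add_ncard_and_not (G.Adj a) (U a)]
    congr 2; ext b
    exact ⟨fun h => ⟨(hUG a b h).1, h⟩, fun h => h.2⟩
  have hHX : ∀ a ∈ X, Even {b | G.Adj a b ∧ ¬ U a b}.ncard := by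
    intro a ha
    have h := hev a ha
    rw [← hsplit a, Nat.even_add] at h
    exact h.1 (hUX a ha)
  have hHY : ∀ b ∉ X, (∃ a, G.Adj a b ∧ ¬ U a b) → Odd {a | G.Adj a b ∧ ¬ U a b}.ncard := by
    rintro b hb ⟨a, hab, hUab⟩
    have hbb : b ≠ b₀ := by
      rintro rfl
      exact hUab ⟨hNX a hab.symm, Or.inr ⟨rfl, hab.symm⟩⟩
    have h1 := ncard_and_add_ncard_and_not (G.Adj b) (F.Adj b)
    have e1 : {x | G.Adj b x ∧ F.Adj b x} = {x | F.Adj b x} := by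
      ext x; exact ⟨fun h => h.2, fun h => ⟨hFG h, h⟩⟩
    have e2 : {a | G.Adj a b ∧ ¬ U a b} = {x | G.Adj b x ∧ ¬ F.Adj b x} := by
      ext x
      simp only [Set.mem_ofPred_eq, hU, hbb, false_and, or_false, G.adj_comm x b, F.adj_comm x b]
      refine and_congr_right fun h => not_congr (and_iff_right ?_)
      have := hX h; tauto
    rw [e1] at h1
    rw [e2]
    have h3 : (Odd {w | F.Adj b w}.ncard ↔ Even {w | G.Adj b w}.ncard) := by
      rw [hFodd b]
      constructor
      · rintro (h | h)
        exacts [absurd (hNX b h) hb, h.1.2.2]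
      · exact fun h => Or.inr ⟨⟨hb, ⟨a, hab.symm⟩, h⟩, hbb⟩
    rw [← h1] at h3
    grind
  have hFN : ∀ a, G.Adj b₀ a → ∃ b, F.Adj a b ∧ ({b | F.Adj a b}.ncard = 1 ∨
      {b | F.Adj a b}.ncard ≠ 1 ∧ ∀ a₂, G.Adj b₀ a₂ → F.Adj a₂ b → a₂ = a) := by
    intro a ha
    have hodd := (hFodd a).2 (Or.inl ha)
    by_cases h1 : {b | F.Adj a b}.ncard = 1
    · obtain ⟨b, hb⟩ := (Set.ncard_pos (Set.toFinite _)).1 hodd.pos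
      exact ⟨b, hb, Or.inl h1⟩
    · have h2 : 2 < {b | F.Adj a b}.ncard := by
        obtain ⟨k, hk⟩ := hodd
        omega
      -- An odd degree other than 1 is at least 3, and at most two neighbors of `a` are shared with
      -- another neighbor of `b₀`.
      obtain ⟨b, hb, hb'⟩ := Set.exists_mem_notMem_of_ncard_lt_ncard ((hbad a ha).trans_lt h2)
      refine ⟨b, hb, Or.inr ⟨h1, fun a₂ h3 h4 => ?_⟩⟩
      by_contra h5
      exact hb' ⟨hFT hb, a₂, h5, h3, hFT h4⟩
  rcases le_or_gt {a | G.Adj b₀ a}.ncard 2 with hd | hd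
  · obtain ⟨W, S, h1, h2, h3, h4, h5, h6⟩ := exists_decomposition_of_degree_le_two hX hb₀ hFG hFa hFb
      (fun a ha => (hFN a ha).imp fun _ h => h.1) hU hUX hpos hd
    exact hasFourColoringFrom_of_decomposition (Z := ∅) hX hUG hHX hHY h4 h5 h1 h2 h3 (by simp)
      (by simp) (fun a ha _ => h6 a ha) (by simp)
  · obtain ⟨W, S, Z, h1, h2, h3, h4, h5, h6, h7, h8, h9⟩ :=
      exists_decomposition_of_two_lt_degree hX hb₀ hFG hFa hFb hFN hU hUX hd
    exact hasFourColoringFrom_of_decomposition hX hUG hHX hHY h4 h5 h1 h2 h3 h6 h7 h8 h9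

/-! ### Gluing components and passing to edge labelings -/

theorem hasFourColoringFrom {G : SimpleGraph V} {X : Set V}
    (hX : ∀ ⦃v w⦄, G.Adj v w → (v ∈ X ↔ w ∉ X))
    (hev : ∀ a ∈ X, Even {b | G.Adj a b}.ncard) : G.HasFourColoringFrom X := by
  -- Each component is kept as a graph on all of `V`; this is why connectivity is only ever required
  -- between non-isolated vertices.
  let H : G.ConnectedComponent → SimpleGraph V := fun K =>
    ⟨fun v w => G.Adj v w ∧ G.connectedComponentMk v = K,
      ⟨fun v w h => ⟨h.1.symm, by rw [← h.2]; exact ConnectedComponent.sound h.1.symm.reachable⟩⟩,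
      ⟨fun v h => h.1.ne rfl⟩⟩
  have hHK : ∀ v w, (H (G.connectedComponentMk v)).Adj v w ↔ G.Adj v w := fun v w =>
    ⟨fun h => h.1, fun h => ⟨h, rfl⟩⟩
  have hcol : ∀ K, (H K).HasFourColoringFrom X := by
    intro K
    have h1 : ∀ ⦃v w⦄, (H K).Adj v w → (v ∈ X ↔ w ∉ X) := fun v w h => hX h.1
    have h2 : ∀ a ∈ X, Even {b | (H K).Adj a b}.ncard := by
      intro a ha
      by_cases hK : G.connectedComponentMk a = K
      · subst hK
        simp only [hHK]
        exact hev a ha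
      · have : {b | (H K).Adj a b} = ∅ := by
          ext b
          simp only [Set.mem_ofPred_eq, Set.mem_empty_iff_false, iff_false]
          exact fun h => hK h.2
        simp [this]
    have h3 : ∀ v w, G.Reachable v w → G.connectedComponentMk v = K → (H K).Reachable v w := by
      intro v w hvw hv
      rw [reachable_iff_reflTransGen] at hvw
      induction hvw with
      | refl => exact Reachable.refl _
      | @tail x y hx hxy ih =>
        refine ih.trans (Adj.reachable ⟨hxy, ?_⟩)
        rw [← hv]
        exact (ConnectedComponent.sound ((reachable_iff_reflTransGen _ _).2 hx)).symm
    have h4 : ∀ v w, (∃ x, (H K).Adj v x) → (∃ x, (H K).Adj w x) → (H K).Reachable v w := by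
      rintro v w ⟨x, hx⟩ ⟨y, hy⟩
      exact h3 v w (ConnectedComponent.exact (hx.2.trans hy.2.symm)) hx.2
    rcases Nat.even_or_odd
      {b | b ∉ X ∧ (∃ x, (H K).Adj b x) ∧ Even {a | (H K).Adj b a}.ncard}.ncard with h | h
    · exact hasFourColoringFrom_of_even h1 h2 h4 h
    · exact hasFourColoringFrom_of_odd h1 h2 h4 h
  choose col hcol using hcol
  refine ⟨fun a b => col (G.connectedComponentMk b) a b, fun a ha b hab => ?_⟩
  have hK : G.connectedComponentMk a = G.connectedComponentMk b :=
    ConnectedComponent.sound hab.reachable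
  have := hcol (G.connectedComponentMk b) a ha b ⟨hab, hK⟩
  convert! this using 3
  · ext b'
    simp only
    constructor
    · rintro ⟨h1, h2⟩
      have h3 : G.connectedComponentMk b' = G.connectedComponentMk b :=
        (ConnectedComponent.sound h1.symm.reachable).trans hK
      exact ⟨⟨h1, hK⟩, h3 ▸ h2⟩
    · rintro ⟨⟨h1, -⟩, h2⟩
      have h3 : G.connectedComponentMk b' = G.connectedComponentMk b :=
        (ConnectedComponent.sound h1.symm.reachable).trans hK
      exact ⟨h1, h3 ▸ h2⟩
  · ext a'
    simp only
    constructor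
    · rintro ⟨h1, h2⟩
      exact ⟨⟨h1, ConnectedComponent.sound h1.reachable⟩, h2⟩
    · rintro ⟨⟨h1, -⟩, h2⟩
      exact ⟨h1, h2⟩

theorem ncard_neighborSet {V : Type*} (G : SimpleGraph V) (v : V) [Fintype (G.neighborSet v)] :
    (G.neighborSet v).ncard = G.degree v := by
  rw [Set.ncard_eq_toFinset_card', ← card_neighborFinset_eq_degree, neighborFinset]

theorem HasFourColoringFrom.locallyIrregularEdgeColorable {V : Type*} [Fintype V]
    {G : SimpleGraph V} {X : Set V} (hX : ∀ ⦃v w⦄, G.Adj v w → (v ∈ X ↔ w ∉ X))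
    (h : G.HasFourColoringFrom X) : G.LocallyIrregularEdgeColorable 4 := by
  classical
  obtain ⟨col, hcol⟩ := h
  let C : G.EdgeLabeling (Fin 4) := EdgeLabeling.mk
    (fun x y _ => if x ∈ X then col x y else col y x) (fun x y hxy => by
      have := hX hxy
      by_cases hx : x ∈ X <;> simp_all)
  have hadj : ∀ k x y, (C.labelGraph k).Adj x y ↔
      G.Adj x y ∧ (if x ∈ X then col x y else col y x) = k := fun k x y => by
    rw [EdgeLabeling.labelGraph_adj]
    exact ⟨fun ⟨h1, h2⟩ => ⟨h1, h2⟩, fun ⟨h1, h2⟩ => ⟨h1, h2⟩⟩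
  have key : ∀ k a b, a ∈ X → (C.labelGraph k).Adj a b →
      ((C.labelGraph k).neighborSet a).ncard ≠ ((C.labelGraph k).neighborSet b).ncard := by
    intro k a b ha hab
    obtain ⟨h1, h2⟩ := (hadj k a b).1 hab
    rw [if_pos ha] at h2
    have hb : b ∉ X := (hX h1).1 ha
    have := hcol a ha b h1
    rw [h2] at this
    convert! this using 3
    · ext x
      rw [mem_neighborSet, hadj, if_pos ha]
      rfl
    · ext x
      rw [mem_neighborSet, hadj, if_neg hb, G.adj_comm]
      rfl
  refine ⟨C, fun k v w hvw => ?_⟩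
  rw [← ncard_neighborSet, ← ncard_neighborSet]
  by_cases hv : v ∈ X
  · exact key k v w hv hvw
  · have hw : w ∈ X := by have := hX ((hadj k v w).1 hvw).1; tauto
    exact (key k w v hw hvw.symm).symm

end SimpleGraph

theorem corollary1 {V : Type*} [Fintype V] (G : SimpleGraph V) (hG : G.IsBalanced) :
    G.locallyIrregularChromaticIndex ≤ 4 := by
  classical
  obtain ⟨E, N, -, hbip, hev⟩ := hG
  have hX : ∀ ⦃v w⦄, G.Adj v w → (v ∈ E ↔ w ∉ E) := by
    intro v w h
    have hd := Set.disjoint_left.1 hbip.disjoint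
    rcases hbip.mem_of_adj h with ⟨h1, h2⟩ | ⟨h1, h2⟩
    · exact ⟨fun _ h3 => hd h3 h2, fun _ => h1⟩
    · exact ⟨fun h3 => absurd h1 (hd h3), fun h3 => absurd h2 h3⟩
  have h : G.HasFourColoringFrom E := SimpleGraph.hasFourColoringFrom hX fun a ha => by
    have := hev a ha
    rwa [← SimpleGraph.ncard_neighborSet] at this
  exact iInf₂_le (4 : ℕ) (h.locallyIrregularEdgeColorable hX)
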